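/- Let $S$ be a Polish space with its Borel $\sigma$-algebra, let $C_b(S)$ be the space of bounded continuous functions $S\to\mathbb{R}$, $\mathcal{P}(S)$ the set of Borel probability measures on $S$, and $\mathcal{M}(S)$ the space of finite signed Borel measures on $S$. Equip $C_b(S)$ with the weak topology induced by $\mathcal{M}(S)$, i.e. the coarsest topology for which $g\mapsto\int_S g\,d\eta$ is continuous for every $\eta\in\mathcal{M}(S)$. Call a set $\Gamma\subset C_b(S)$ admissible if 1. $\Gamma$ is convex, and closed in this weak topology; 2. $g\in\Gamma$ implies $-g\in\Gamma$, and $\Gamma$ contains all constant functions; 3. for all $\mu,\nu\in\mathcal{P}(S)$ with $\mu\neq\nu$ there is $g\in\Gamma$ with $\int_S g\,d\mu\neq\int_S g\,d\nu$. For $\gamma,\nu\in\mathcal{P}(S)$ let $R(\gamma\|\nu)=\int_S\log\frac{d\gamma}{d\nu}\,d\gamma\in[0,\infty]$ if $\gamma\ll\nu$, and $R(\gamma\|\nu)=\infty$ otherwise (relative entropy). For $\mu,\eta\in\mathcal{M}(S)$ and $\nu\in\mathcal{P}(S)$ let $$G_\Gamma(\mu\|\nu)=\sup_{g\in\Gamma}\left\{\int_S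 g\,d\mu-\log\int_S e^g\,d\nu\right\},\qquad W_\Gamma(\eta)=\sup_{g\in\Gamma}\int_S g\,d\eta,$$ with values in $(-\infty,\infty]$. **Theorem.** If $\Gamma$ is admissible, then for all $\mu\in\mathcal{M}(S)$ and $\nu\in\mathcal{P}(S)$, $$G_\Gamma(\mu\|\nu)=\inf_{\gamma\in\mathcal{P}(S)}\left\{R(\gamma\|\nu)+W_\Gamma(\mu-\gamma)\right\},$$ as an identity in $(-\infty,\infty]$. -/

import Mathlib

open MeasureTheory Topology
open scoped BoundedContinuousFunction

namespace GammaDivergence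

noncomputable section

variable {S : Type*} [TopologicalSpace S] [MeasurableSpace S]

/-- The pairing `⟨g, η⟩ = ∫ g dη` of a bounded continuous function with a finite signed measure. -/
def pairing (g : S →ᵇ ℝ) (η : SignedMeasure S) : ℝ :=
  ∫ᵛ x, g x ∂<•η

/-- The integral in `pairing` is always that of an integrable function. -/
theorem integrable_pairing [BorelSpace S] (g : S →ᵇ ℝ) (η : SignedMeasure S) :
    η.Integrable g := by
  have : IsFiniteMeasure η.variation := by
    rw [← SignedMeasure.totalVariation_eq_variation]
    unfold SignedMeasure.totalVariation
    infer_instance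
  exact g.integrable η.variation

variable (S) in
/-- The weak topology on `C_b(S)` induced by the finite signed measures: the coarsest topology
for which `g ↦ ∫ g dη` is continuous for every finite signed measure `η`. -/
abbrev weakTopology : TopologicalSpace (S →ᵇ ℝ) :=
  TopologicalSpace.induced (fun g η => pairing g η)
    (inferInstance : TopologicalSpace (SignedMeasure S → ℝ))

/-- Admissible sets of test functions. -/
structure IsAdmissible [BorelSpace S] (Γ : Set (S →ᵇ ℝ)) : Prop where
  convex : Convex ℝ Γ
  isClosed : IsClosed[weakTopology S] Γ
  neg_mem : ∀ g ∈ Γ, -g ∈ Γ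
  const_mem : ∀ c : ℝ, BoundedContinuousFunction.const S c ∈ Γ
  determining : ∀ μ ν : ProbabilityMeasure S, μ ≠ ν →
    ∃ g ∈ Γ, ∫ x, g x ∂(μ : Measure S) ≠ ∫ x, g x ∂(ν : Measure S)

/-- The `Γ`-divergence `G_Γ(μ‖ν) = sup_{g ∈ Γ} (∫ g dμ - log ∫ e^g dν)`. -/
def gammaDiv (Γ : Set (S →ᵇ ℝ)) (μ : SignedMeasure S) (ν : ProbabilityMeasure S) : EReal :=
  ⨆ g ∈ Γ, ((pairing g μ - Real.log (∫ x, Real.exp (g x) ∂(ν : Measure S)) : ℝ) : EReal)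

/-- `W_Γ(η) = sup_{g ∈ Γ} ∫ g dη`. -/
def gammaWeight (Γ : Set (S →ᵇ ℝ)) (η : SignedMeasure S) : EReal :=
  ⨆ g ∈ Γ, ((pairing g η : ℝ) : EReal)

/-- Relative entropy `R(γ‖ν)` of probability measures: `∫ log (dγ/dν) dγ` if `γ ≪ ν` (which is
`∞` if `log (dγ/dν)` is not `γ`-integrable, its negative part being integrable), and `∞`
otherwise. -/
def relEntropy (γ ν : ProbabilityMeasure S) : EReal :=
  ((InformationTheory.klDiv (γ : Measure S) (ν : Measure S) : ENNReal) : EReal)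

end

end GammaDivergence

/-! Write `Λ g = log ∫ e^g dν` and `J g = ∫ g dμ - Λ g`. That `J g` is at most each term of the
infimum is Donsker–Varadhan. For the converse let `c = sup_Γ J` be finite; a minimizer `γ` is built
directly, without a minimax theorem. The squared `L²(ν)` distance between square roots of tilted
densities is at most the midpoint convexity gap of `Λ`, hence at most the sum of the two defects `c
- J`. So along a maximizing sequence these roots converge, to some `v`, and `γ = v² ν`. Moving the
sequence slightly towards any `g ∈ Γ` keeps it maximizing, with the same limit, and the first-order
condition gives `R(γₙ‖ν) ≤ c - ∫ g dμ + ∫ g dγₙ + o(1)` for the tilted measures `γₙ`. Lower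
semicontinuity of `R` passes this to `γ`; the supremum over `g` finishes. -/

open InformationTheory Filter

namespace GammaDivergence

/-! ### Relative entropy and square roots of densities -/

section RelativeEntropy

variable {α : Type*} {mα : MeasurableSpace α} {ν γ : Measure α}

/-- The measure with density `u ^ 2` with respect to `ν`, for `u ∈ L²(ν)`. -/
noncomputable def sqMeasure (u : Lp ℝ 2 ν) : Measure α :=
  ν.withDensity fun x ↦ ENNReal.ofReal (u x ^ 2)

theorem measurable_ofReal_sq (u : Lp ℝ 2 ν) : Measurable fun x ↦ ENNReal.ofReal (u x ^ 2) :=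
  ((Lp.stronglyMeasurable u).measurable.pow_const 2).ennreal_ofReal

theorem isProbabilityMeasure_sqMeasure {u : Lp ℝ 2 ν} (hu : ‖u‖ = 1) :
    IsProbabilityMeasure (sqMeasure u) := by
  have h : ∫ x, u x ^ 2 ∂ν = 1 := by
    have := real_inner_self_eq_norm_sq u
    rw [L2.inner_def, hu] at this
    simpa [pow_two] using this
  refine ⟨?_⟩
  rw [sqMeasure, withDensity_apply _ MeasurableSet.univ, setLIntegral_univ,
    ← ofReal_integral_eq_lintegral_ofReal (Lp.memLp u).integrable_sq
      (ae_of_all _ fun x ↦ sq_nonneg _), h, ENNReal.ofReal_one]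

theorem integral_sqMeasure (u : Lp ℝ 2 ν) (f : α → ℝ) :
    ∫ x, f x ∂(sqMeasure u) = ∫ x, u x ^ 2 * f x ∂ν := by
  rw [sqMeasure, integral_withDensity_eq_integral_toReal_smul (measurable_ofReal_sq u)
    (ae_of_all _ fun _ ↦ ENNReal.ofReal_lt_top)]
  exact integral_congr_ae (ae_of_all _ fun x ↦ by
    simp [ENNReal.toReal_ofReal (sq_nonneg (u x))])

/-- Integrals of bounded functions against `u ^ 2 • ν` depend continuously on `u ∈ L²(ν)`. -/
theorem tendsto_integral_sqMeasure {u : ℕ → Lp ℝ 2 ν} {v : Lp ℝ 2 ν}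
    (huv : Tendsto u atTop (𝓝 v)) {f : α → ℝ} (hf : AEStronglyMeasurable f ν) {C : ℝ}
    (hC : ∀ x, ‖f x‖ ≤ C) :
    Tendsto (fun n ↦ ∫ x, f x ∂(sqMeasure (u n))) atTop (𝓝 (∫ x, f x ∂(sqMeasure v))) := by
  have hm (w : Lp ℝ 2 ν) : MemLp (fun x ↦ f x * w x) 2 ν :=
    (Lp.memLp w).of_le_mul (hf.mul (Lp.aestronglyMeasurable w)) (ae_of_all _ fun x ↦ by
      rw [norm_mul]; exact mul_le_mul_of_nonneg_right (hC x) (norm_nonneg _))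
  have hT : Tendsto (fun n ↦ (hm (u n)).toLp) atTop (𝓝 (hm v).toLp) := by
    rw [tendsto_iff_norm_sub_tendsto_zero] at huv ⊢
    refine squeeze_zero (fun _ ↦ norm_nonneg _) (fun n ↦ ?_) (by simpa using huv.const_mul C)
    refine Lp.norm_le_mul_norm_of_ae_le_mul ?_
    filter_upwards [Lp.coeFn_sub (hm (u n)).toLp (hm v).toLp, Lp.coeFn_sub (u n) v,
      (hm (u n)).coeFn_toLp, (hm v).coeFn_toLp] with x h1 h2 h3 h4
    rw [h1, h2, Pi.sub_apply, Pi.sub_apply, h3, h4, ← mul_sub, norm_mul]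
    exact mul_le_mul_of_nonneg_right (hC x) (norm_nonneg _)
  -- Multiplication by the bounded `f` is continuous on `L²`, so the integral is a continuous
  -- quadratic form in `w`.
  have key (w : Lp ℝ 2 ν) : ∫ x, f x ∂(sqMeasure w) = inner ℝ w (hm w).toLp := by
    rw [integral_sqMeasure, L2.inner_def]
    refine integral_congr_ae ?_
    filter_upwards [(hm w).coeFn_toLp] with x hx
    rw [hx]
    simp only [RCLike.inner_apply, conj_trivial]
    ring
  simp_rw [key]
  exact huv.inner hT

variable [IsProbabilityMeasure ν]

/-- The **Donsker–Varadhan inequality**. -/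
theorem integral_sub_log_integral_exp_le [IsProbabilityMeasure γ] {f : α → ℝ}
    (hγ : γ ≪ ν) (hfγ : Integrable f γ) (hfν : Integrable (fun x ↦ Real.exp (f x)) ν)
    (hint : Integrable (llr γ ν) γ) :
    ∫ x, f x ∂γ - Real.log (∫ x, Real.exp (f x) ∂ν) ≤ ∫ x, llr γ ν x ∂γ := by
  have := isProbabilityMeasure_tilted hfν
  -- Nonnegativity of `R(γ‖ν.tilted f)`, rearranged.
  have h := integral_llr_add_sub_measure_univ_nonneg
    (hγ.trans (absolutelyContinuous_tilted hfν)) (integrable_llr_tilted_right hγ hfγ hint hfν)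
  rw [integral_llr_tilted_right hγ hfγ hfν hint] at h
  simp only [probReal_univ] at h
  linarith

theorem llr_tilted_self {f : α → ℝ} (hf : Integrable (fun x ↦ Real.exp (f x)) ν) :
    llr (ν.tilted f) ν =ᵐ[ν.tilted f] fun x ↦ f x - Real.log (∫ x, Real.exp (f x) ∂ν) :=
  (tilted_absolutelyContinuous ν f).ae_le (log_rnDeriv_tilted_left_self hf)

theorem integrable_llr_tilted_self {f : α → ℝ} (hf : Integrable (fun x ↦ Real.exp (f x)) ν)
    (hf' : Integrable f (ν.tilted f)) : Integrable (llr (ν.tilted f) ν) (ν.tilted f) := by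
  rw [integrable_congr (llr_tilted_self hf)]
  exact hf'.sub (integrable_const _)

theorem integral_llr_tilted_self {f : α → ℝ} (hf : Integrable (fun x ↦ Real.exp (f x)) ν)
    (hf' : Integrable f (ν.tilted f)) :
    ∫ x, llr (ν.tilted f) ν x ∂(ν.tilted f) =
      ∫ x, f x ∂(ν.tilted f) - Real.log (∫ x, Real.exp (f x) ∂ν) := by
  have := isProbabilityMeasure_tilted hf
  rw [integral_congr_ae (llr_tilted_self hf), integral_sub hf' (integrable_const _)]
  simp

theorem klDiv_tilted_self {f : α → ℝ} (hf : Integrable (fun x ↦ Real.exp (f x)) ν)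
    (hf' : Integrable f (ν.tilted f)) :
    klDiv (ν.tilted f) ν =
      ENNReal.ofReal (∫ x, f x ∂(ν.tilted f) - Real.log (∫ x, Real.exp (f x) ∂ν)) := by
  have := isProbabilityMeasure_tilted hf
  rw [klDiv_of_ac_of_integrable (tilted_absolutelyContinuous ν f)
    (integrable_llr_tilted_self hf hf'), integral_llr_tilted_self hf hf']
  simp

/-- The integrand `klFun` is nonnegative, unlike `t log t`, which makes Fatou's lemma available. -/
theorem klDiv_sqMeasure (u : Lp ℝ 2 ν) [IsFiniteMeasure (sqMeasure u)] :
    klDiv (sqMeasure u) ν = ∫⁻ x, ENNReal.ofReal (klFun (u x ^ 2)) ∂ν := by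
  have hac : sqMeasure u ≪ ν := withDensity_absolutelyContinuous _ _
  rw [klDiv_eq_lintegral_klFun_of_ac hac]
  refine lintegral_congr_ae ?_
  filter_upwards [Measure.rnDeriv_withDensity ν (measurable_ofReal_sq u)] with x hx
  rw [sqMeasure, hx, ENNReal.toReal_ofReal (sq_nonneg _)]

/-- Relative entropy is lower semicontinuous along `L²`-convergence of square roots of
densities. -/
theorem klDiv_sqMeasure_le_of_tendsto {u : ℕ → Lp ℝ 2 ν} {v : Lp ℝ 2 ν}
    (huv : Tendsto u atTop (𝓝 v)) [∀ n, IsFiniteMeasure (sqMeasure (u n))]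
    [IsFiniteMeasure (sqMeasure v)] {a : ℕ → ENNReal} {b : ENNReal}
    (ha : Tendsto a atTop (𝓝 b)) (hle : ∀ n, klDiv (sqMeasure (u n)) ν ≤ a n) :
    klDiv (sqMeasure v) ν ≤ b := by
  obtain ⟨φ, hφ, hae⟩ := (tendstoInMeasure_of_tendsto_Lp huv).exists_seq_tendsto_ae
  have hmeas (w : Lp ℝ 2 ν) : Measurable fun x ↦ ENNReal.ofReal (klFun (w x ^ 2)) :=
    (measurable_klFun.comp ((Lp.stronglyMeasurable w).measurable.pow_const 2)).ennreal_ofReal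
  calc klDiv (sqMeasure v) ν
      = ∫⁻ x, liminf (fun n ↦ ENNReal.ofReal (klFun (u (φ n) x ^ 2))) atTop ∂ν := by
        rw [klDiv_sqMeasure]
        refine lintegral_congr_ae ?_
        filter_upwards [hae] with x hx
        have hc : Continuous fun t : ℝ ↦ ENNReal.ofReal (klFun (t ^ 2)) :=
          ENNReal.continuous_ofReal.comp (continuous_klFun.comp (continuous_pow 2))
        exact ((hc.tendsto _).comp hx).liminf_eq.symm
    _ ≤ liminf (fun n ↦ ∫⁻ x, ENNReal.ofReal (klFun (u (φ n) x ^ 2)) ∂ν) atTop :=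
        lintegral_liminf_le fun n ↦ hmeas _
    _ ≤ liminf (fun n ↦ a (φ n)) atTop :=
        liminf_le_liminf (Eventually.of_forall fun n ↦ (klDiv_sqMeasure (u (φ n))).symm.trans_le
          (hle _))
    _ = b := (ha.comp hφ.tendsto_atTop).liminf_eq

end RelativeEntropy

/-! ### Tilted measures and their Hellinger distance -/

section Tilting

variable {S : Type*} [TopologicalSpace S] [MeasurableSpace S]

theorem pairing_smul (t : ℝ) (g : S →ᵇ ℝ) (η : SignedMeasure S) :
    pairing (t • g) η = t * pairing g η :=
  VectorMeasure.integral_fun_smul η _ t g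

variable [BorelSpace S]

theorem pairing_add (g h : S →ᵇ ℝ) (η : SignedMeasure S) :
    pairing (g + h) η = pairing g η + pairing h η :=
  VectorMeasure.integral_fun_add (integrable_pairing g η) (integrable_pairing h η)

theorem pairing_sub (g h : S →ᵇ ℝ) (η : SignedMeasure S) :
    pairing (g - h) η = pairing g η - pairing h η :=
  VectorMeasure.integral_fun_sub (integrable_pairing g η) (integrable_pairing h η)

theorem pairing_sub_toSignedMeasure (g : S →ᵇ ℝ) (η : SignedMeasure S) (γ : Measure S)
    [IsFiniteMeasure γ] : pairing g (η - γ.toSignedMeasure) = pairing g η - ∫ x, g x ∂γ := by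
  have h := VectorMeasure.integral_sub_vectorMeasure (B := (ContinuousLinearMap.lsmul ℝ ℝ).flip)
    (integrable_pairing g η) (integrable_pairing g γ.toSignedMeasure)
  rw [VectorMeasure.integral_toSignedMeasure] at h
  exact h

variable {ν : Measure S} [IsProbabilityMeasure ν]

theorem integrable_exp (g : S →ᵇ ℝ) : Integrable (fun x ↦ Real.exp (g x)) ν := by
  refine Integrable.of_bound (C := Real.exp ‖g‖)
    (Real.continuous_exp.comp g.continuous).aestronglyMeasurable (ae_of_all _ fun x ↦ ?_)
  rw [Real.norm_eq_abs, Real.abs_exp]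
  exact Real.exp_le_exp.2 ((le_abs_self _).trans (g.norm_coe_le_norm x))

instance (g : S →ᵇ ℝ) : IsProbabilityMeasure (ν.tilted g) :=
  isProbabilityMeasure_tilted (integrable_exp g)

variable (ν) in
/-- The logarithm of the exponential moment `∫ e^g dν`. -/
noncomputable def logExpMoment (g : S →ᵇ ℝ) : ℝ := Real.log (∫ x, Real.exp (g x) ∂ν)

theorem exp_logExpMoment (g : S →ᵇ ℝ) :
    Real.exp (logExpMoment ν g) = ∫ x, Real.exp (g x) ∂ν :=
  Real.exp_log (integral_exp_pos (integrable_exp g))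

/-- The subgradient inequality for `logExpMoment`. -/
theorem logExpMoment_add_integral_sub_le (h k : S →ᵇ ℝ) :
    logExpMoment ν h + (∫ x, k x ∂(ν.tilted h) - ∫ x, h x ∂(ν.tilted h)) ≤ logExpMoment ν k := by
  have h1 := integral_sub_log_integral_exp_le (tilted_absolutelyContinuous ν h)
    (k.integrable (ν.tilted h)) (integrable_exp k)
    (integrable_llr_tilted_self (integrable_exp h) (h.integrable _))
  rw [integral_llr_tilted_self (integrable_exp h) (h.integrable _)] at h1
  unfold logExpMoment
  linarith

variable (ν) in
theorem memLp_exp_half_sub (h : S →ᵇ ℝ) (c : ℝ) : MemLp (fun x ↦ Real.exp ((h x - c) / 2)) 2 ν := by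
  have hcont : Continuous fun x ↦ Real.exp ((h x - c) / 2) := by fun_prop
  refine MemLp.of_bound hcont.aestronglyMeasurable
    (Real.exp ((‖h‖ - c) / 2)) (ae_of_all _ fun x ↦ ?_)
  rw [Real.norm_eq_abs, Real.abs_exp]
  have := (le_abs_self _).trans (h.norm_coe_le_norm x)
  gcongr

variable (ν) in
/-- The square root of the density of `ν.tilted h` with respect to `ν`, as an element of `L²`. -/
noncomputable def sqrtDensity (h : S →ᵇ ℝ) : Lp ℝ 2 ν :=
  (memLp_exp_half_sub ν h (logExpMoment ν h)).toLp

theorem sqrtDensity_ae (h : S →ᵇ ℝ) :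
    sqrtDensity ν h =ᵐ[ν] fun x ↦ Real.exp ((h x - logExpMoment ν h) / 2) :=
  MemLp.coeFn_toLp _

theorem sqMeasure_sqrtDensity (h : S →ᵇ ℝ) : sqMeasure (sqrtDensity ν h) = ν.tilted h := by
  refine withDensity_congr_ae ?_
  filter_upwards [sqrtDensity_ae (ν := ν) h] with x hx
  rw [hx, ← exp_logExpMoment, ← Real.exp_sub, ← Real.exp_nat_mul]
  congr 2
  push_cast
  ring

/-- The Hellinger affinity of two tilted measures. -/
theorem inner_sqrtDensity (h k : S →ᵇ ℝ) :
    inner ℝ (sqrtDensity ν h) (sqrtDensity ν k) =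
      Real.exp (logExpMoment ν ((1 / 2 : ℝ) • h + (1 / 2 : ℝ) • k) -
        (logExpMoment ν h + logExpMoment ν k) / 2) := by
  rw [L2.inner_def, Real.exp_sub, exp_logExpMoment, ← integral_div]
  refine integral_congr_ae ?_
  filter_upwards [sqrtDensity_ae (ν := ν) h, sqrtDensity_ae (ν := ν) k] with x h1 h2
  rw [h1, h2, ← Real.exp_sub]
  simp only [RCLike.inner_apply, conj_trivial, ← Real.exp_add, BoundedContinuousFunction.add_apply,
    BoundedContinuousFunction.smul_apply, smul_eq_mul]
  congr 1
  ring

theorem norm_sqrtDensity (h : S →ᵇ ℝ) : ‖sqrtDensity ν h‖ = 1 := by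
  have h1 := inner_sqrtDensity (ν := ν) h h
  rw [← add_smul, add_halves, one_smul, add_self_div_two, sub_self, Real.exp_zero,
    real_inner_self_eq_norm_sq] at h1
  nlinarith [norm_nonneg (sqrtDensity ν h)]

/-- The left side is `2 - 2 e^s`, with `e^s` the Hellinger affinity; use `e^s ≥ 1 + s`. -/
theorem norm_sqrtDensity_sub_sq_le (h k : S →ᵇ ℝ) :
    ‖sqrtDensity ν h - sqrtDensity ν k‖ ^ 2 ≤ logExpMoment ν h + logExpMoment ν k -
      2 * logExpMoment ν ((1 / 2 : ℝ) • h + (1 / 2 : ℝ) • k) := by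
  rw [norm_sub_sq_real, norm_sqrtDensity, norm_sqrtDensity, inner_sqrtDensity]
  have := Real.add_one_le_exp (logExpMoment ν ((1 / 2 : ℝ) • h + (1 / 2 : ℝ) • k) -
        (logExpMoment ν h + logExpMoment ν k) / 2)
  linarith

end Tilting

/-! ### Maximizing sequences and the dual optimizer -/

section Duality

variable {S : Type*} [TopologicalSpace S] [MeasurableSpace S] [BorelSpace S]
  {Γ : Set (S →ᵇ ℝ)} {μ : SignedMeasure S} {ν : Measure S} [IsProbabilityMeasure ν] {c : ℝ}

variable (μ ν) in
/-- The functional maximized over `Γ` in the definition of the `Γ`-divergence. -/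
noncomputable def dualObjective (g : S →ᵇ ℝ) : ℝ := pairing g μ - logExpMoment ν g

theorem dualObjective_le (h k : S →ᵇ ℝ) :
    dualObjective μ ν k ≤ dualObjective μ ν h +
      (pairing (k - h) μ - (∫ x, k x ∂(ν.tilted h) - ∫ x, h x ∂(ν.tilted h))) := by
  have := logExpMoment_add_integral_sub_le (ν := ν) h k
  rw [pairing_sub]
  unfold dualObjective
  linarith

theorem integral_tilted_sub_logExpMoment_nonneg (h : S →ᵇ ℝ) :
    0 ≤ ∫ x, h x ∂(ν.tilted h) - logExpMoment ν h := by
  have h1 := integral_llr_add_sub_measure_univ_nonneg (tilted_absolutelyContinuous ν h)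
    (integrable_llr_tilted_self (integrable_exp h) (h.integrable _))
  rw [integral_llr_tilted_self (integrable_exp h) (h.integrable _)] at h1
  simpa [logExpMoment] using h1

/-- The pairing is linear, so the convexity gap of `logExpMoment` is the concavity gap of
`dualObjective`, whose value at the midpoint is at most `c`. -/
theorem norm_sqrtDensity_sub_sq_le_of_forall_le (hconv : Convex ℝ Γ)
    (hc : ∀ g ∈ Γ, dualObjective μ ν g ≤ c) {h k : S →ᵇ ℝ} (hh : h ∈ Γ) (hk : k ∈ Γ) :
    ‖sqrtDensity ν h - sqrtDensity ν k‖ ^ 2 ≤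
      (c - dualObjective μ ν h) + (c - dualObjective μ ν k) := by
  have h1 := norm_sqrtDensity_sub_sq_le (ν := ν) h k
  have h2 := hc _ (hconv hh hk (by norm_num : (0 : ℝ) ≤ 1 / 2) (by norm_num : (0 : ℝ) ≤ 1 / 2)
    (by norm_num))
  unfold dualObjective at *
  rw [pairing_add, pairing_smul, pairing_smul] at h2
  linarith

theorem tendsto_sqrtDensity_sub (hconv : Convex ℝ Γ)
    (hc : ∀ g ∈ Γ, dualObjective μ ν g ≤ c) {h k : ℕ → S →ᵇ ℝ} (hh : ∀ n, h n ∈ Γ)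
    (hk : ∀ n, k n ∈ Γ) (hhc : Tendsto (fun n ↦ dualObjective μ ν (h n)) atTop (𝓝 c))
    (hkc : Tendsto (fun n ↦ dualObjective μ ν (k n)) atTop (𝓝 c)) :
    Tendsto (fun n ↦ sqrtDensity ν (h n) - sqrtDensity ν (k n)) atTop (𝓝 0) := by
  rw [tendsto_zero_iff_norm_tendsto_zero]
  have h1 : Tendsto (fun n ↦ ‖sqrtDensity ν (h n) - sqrtDensity ν (k n)‖ ^ 2) atTop (𝓝 0) :=
    squeeze_zero (fun _ ↦ sq_nonneg _)
      (fun n ↦ norm_sqrtDensity_sub_sq_le_of_forall_le hconv hc (hh n) (hk n))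
      (by simpa using (hhc.const_sub c).add (hkc.const_sub c))
  simpa [Real.sqrt_sq (norm_nonneg _)] using h1.sqrt

theorem cauchySeq_sqrtDensity (hconv : Convex ℝ Γ)
    (hc : ∀ g ∈ Γ, dualObjective μ ν g ≤ c) {h : ℕ → S →ᵇ ℝ} (hh : ∀ n, h n ∈ Γ)
    (hhc : Tendsto (fun n ↦ dualObjective μ ν (h n)) atTop (𝓝 c)) :
    CauchySeq fun n ↦ sqrtDensity ν (h n) := by
  rw [Metric.cauchySeq_iff]
  intro ε hε
  have h1 : ∀ᶠ n in atTop, c - ε ^ 2 / 2 < dualObjective μ ν (h n) :=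
    hhc.eventually (lt_mem_nhds (by linarith [sq_pos_of_pos hε]))
  obtain ⟨N, hN⟩ := eventually_atTop.1 h1
  refine ⟨N, fun m hm n hn ↦ ?_⟩
  rw [dist_eq_norm]
  refine lt_of_pow_lt_pow_left₀ 2 hε.le ?_
  have := norm_sqrtDensity_sub_sq_le_of_forall_le hconv hc (hh m) (hh n)
  linarith [hN m hm, hN n hn]

/-- Moving a near-maximizer `k` of the dual objective towards `g` by the amount `t` gives a
near-maximizer `h` at which the derivative in the direction of `g` is almost nonpositive. -/
theorem exists_near_maximizer (hconv : Convex ℝ Γ) (hc : ∀ g ∈ Γ, dualObjective μ ν g ≤ c)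
    {g k : S →ᵇ ℝ} (hg : g ∈ Γ) (hk : k ∈ Γ) {t : ℝ} (ht0 : 0 < t) (ht1 : t < 1)
    (hkc : c - t ^ 2 ≤ dualObjective μ ν k) :
    ∃ h ∈ Γ, c - t ^ 2 - t * (c - dualObjective μ ν g) ≤ dualObjective μ ν h ∧
      ∫ x, h x ∂(ν.tilted h) - logExpMoment ν h ≤
        c + t - pairing g μ + ∫ x, g x ∂(ν.tilted h) := by
  set h : S →ᵇ ℝ := (1 - t) • k + t • g with hdef
  have hhΓ : h ∈ Γ := hconv hk hg (by linarith) ht0.le (by ring)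
  have hI : ∫ x, h x ∂(ν.tilted h) =
      (1 - t) * ∫ x, k x ∂(ν.tilted h) + t * ∫ x, g x ∂(ν.tilted h) := by
    have : ∀ x, h x = (1 - t) * k x + t * g x := fun x ↦ by simp [hdef]
    simp_rw [this]
    rw [integral_add ((k.integrable _).const_mul _) ((g.integrable _).const_mul _),
      integral_const_mul, integral_const_mul]
  have hP : pairing h μ = (1 - t) * pairing k μ + t * pairing g μ := by
    rw [hdef, pairing_add, pairing_smul, pairing_smul]
  have e1 := dualObjective_le (μ := μ) (ν := ν) h k
  have e2 := dualObjective_le (μ := μ) (ν := ν) h g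
  have e3 := hc h hhΓ
  have e4 := hc g hg
  rw [pairing_sub, hI, hP] at e1 e2
  -- `X` is the derivative of the objective at `h` in the direction `g - k`.
  set X := pairing g μ - pairing k μ -
    (∫ x, g x ∂(ν.tilted h) - ∫ x, k x ∂(ν.tilted h)) with hX
  have f1 : dualObjective μ ν k ≤ dualObjective μ ν h - t * X := by rw [hX]; linarith
  have f2 : dualObjective μ ν g ≤ dualObjective μ ν h + (1 - t) * X := by rw [hX]; linarith
  -- `k` is optimal up to `t ^ 2` and lies at parameter distance `t` from `h`, so the slope is at
  -- most `t ^ 2 / t`.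
  have hXt : X ≤ t := by nlinarith
  refine ⟨h, hhΓ, by nlinarith, ?_⟩
  have f3 : (1 - t) * X ≤ t := by nlinarith
  have f4 : ∫ x, h x ∂(ν.tilted h) - logExpMoment ν h =
      dualObjective μ ν h + (1 - t) * X - pairing g μ + ∫ x, g x ∂(ν.tilted h) := by
    rw [hX, hI, dualObjective, hP]
    ring
  rw [f4]
  linarith

/-- The infimum in the variational formula is attained. -/
theorem exists_klDiv_le (hconv : Convex ℝ Γ) (hc : IsLUB (dualObjective μ ν '' Γ) c) :
    ∃ γ : Measure S, ∃ _ : IsProbabilityMeasure γ, ∀ g ∈ Γ,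
      0 ≤ c - pairing g μ + ∫ x, g x ∂γ ∧
        klDiv γ ν ≤ ENNReal.ofReal (c - pairing g μ + ∫ x, g x ∂γ) := by
  have hc' : ∀ g ∈ Γ, dualObjective μ ν g ≤ c := fun g hg ↦ hc.1 ⟨g, hg, rfl⟩
  -- The shift makes `t 0 = 1 / 2`, so that every step is strictly below `1`.
  let t : ℕ → ℝ := fun n ↦ 1 / ((n + 1 : ℕ) + 1 : ℝ)
  have ht0 (n : ℕ) : 0 < t n := by positivity
  have ht1 (n : ℕ) : t n < 1 := by
    rw [div_lt_one (by positivity)]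
    push_cast
    linarith [Nat.cast_nonneg (α := ℝ) n]
  have ht : Tendsto t atTop (𝓝 0) :=
    (tendsto_add_atTop_iff_nat 1).2 (tendsto_one_div_add_atTop_nhds_zero_nat (𝕜 := ℝ))
  have hk : ∀ n, ∃ k ∈ Γ, c - t n ^ 2 ≤ dualObjective μ ν k := fun n ↦ by
    obtain ⟨_, ⟨k, hk, rfl⟩, h1, -⟩ :=
      hc.exists_between (show c - t n ^ 2 < c by linarith [sq_pos_of_pos (ht0 n)])
    exact ⟨k, hk, h1.le⟩
  choose k hkΓ hkc using hk
  have hklim : Tendsto (fun n ↦ dualObjective μ ν (k n)) atTop (𝓝 c) :=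
    tendsto_of_tendsto_of_tendsto_of_le_of_le (by simpa using (ht.pow 2).const_sub c)
      tendsto_const_nhds hkc fun n ↦ hc' _ (hkΓ n)
  obtain ⟨v, hv⟩ := cauchySeq_tendsto_of_complete (cauchySeq_sqrtDensity hconv hc' hkΓ hklim)
  have hv1 : ‖v‖ = 1 := tendsto_nhds_unique hv.norm (by simp [norm_sqrtDensity])
  have hvprob := isProbabilityMeasure_sqMeasure hv1
  refine ⟨sqMeasure v, hvprob, fun g hg ↦ ?_⟩
  -- The sequence `h` depends on `g`, but it is again maximizing, so its root densities have the
  -- same limit `v`.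
  choose h hhΓ hhc hh using fun n ↦
    exists_near_maximizer hconv hc' hg (hkΓ n) (ht0 n) (ht1 n) (hkc n)
  have hhlim : Tendsto (fun n ↦ dualObjective μ ν (h n)) atTop (𝓝 c) :=
    tendsto_of_tendsto_of_tendsto_of_le_of_le
      (by simpa using ((ht.pow 2).const_sub c).sub (ht.mul_const (c - dualObjective μ ν g)))
      tendsto_const_nhds hhc fun n ↦ hc' _ (hhΓ n)
  have hhv : Tendsto (fun n ↦ sqrtDensity ν (h n)) atTop (𝓝 v) := by
    simpa using (tendsto_sqrtDensity_sub hconv hc' hhΓ hkΓ hhlim hklim).add hv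
  have hint : Tendsto (fun n ↦ ∫ x, g x ∂(ν.tilted (h n))) atTop (𝓝 (∫ x, g x ∂(sqMeasure v))) := by
    simpa only [sqMeasure_sqrtDensity] using tendsto_integral_sqMeasure hhv
      g.continuous.aestronglyMeasurable g.norm_coe_le_norm
  have hlim : Tendsto (fun n ↦ c + t n - pairing g μ + ∫ x, g x ∂(ν.tilted (h n))) atTop
      (𝓝 (c - pairing g μ + ∫ x, g x ∂(sqMeasure v))) := by
    simpa using ((ht.const_add c).sub_const (pairing g μ)).add hint
  refine ⟨ge_of_tendsto' hlim fun n ↦ (integral_tilted_sub_logExpMoment_nonneg (h n)).trans (hh n),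
    ?_⟩
  have (n : ℕ) : IsFiniteMeasure (sqMeasure (sqrtDensity ν (h n))) := by
    rw [sqMeasure_sqrtDensity]; infer_instance
  refine klDiv_sqMeasure_le_of_tendsto hhv ((ENNReal.continuous_ofReal.tendsto _).comp hlim)
    fun n ↦ ?_
  rw [sqMeasure_sqrtDensity, klDiv_tilted_self (integrable_exp _) ((h n).integrable _)]
  exact ENNReal.ofReal_le_ofReal (hh n)

theorem dualObjective_le_relEntropy_add_gammaWeight {ν : ProbabilityMeasure S} {g : S →ᵇ ℝ}
    (hg : g ∈ Γ) (γ : ProbabilityMeasure S) :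
    ((dualObjective μ (ν : Measure S) g : ℝ) : EReal) ≤
      relEntropy γ ν + gammaWeight Γ (μ - (γ : Measure S).toSignedMeasure) := by
  have hW : ((pairing g (μ - (γ : Measure S).toSignedMeasure) : ℝ) : EReal) ≤
      gammaWeight Γ (μ - (γ : Measure S).toSignedMeasure) :=
    le_iSup₂ (f := fun (g : S →ᵇ ℝ) (_ : g ∈ Γ) ↦
      ((pairing g (μ - (γ : Measure S).toSignedMeasure) : ℝ) : EReal)) g hg
  -- With a real second summand, infinite entropy makes the sum `⊤`, whatever the convention for `⊤
  -- + ⊥`.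
  refine le_trans ?_ (add_le_add_right hW _)
  unfold relEntropy
  by_cases htop : klDiv (γ : Measure S) (ν : Measure S) = ⊤
  · simp [htop]
  obtain ⟨hac, hllr⟩ := klDiv_ne_top_iff.1 htop
  rw [← ENNReal.ofReal_toReal htop, toReal_klDiv_of_measure_eq hac (by simp),
    EReal.coe_ennreal_ofReal]
  have h1 := integral_sub_log_integral_exp_le hac (g.integrable _) (integrable_exp g) hllr
  rw [pairing_sub_toSignedMeasure, ← EReal.coe_add, EReal.coe_le_coe_iff]
  unfold dualObjective logExpMoment
  linarith [le_max_left (∫ x, llr (γ : Measure S) (ν : Measure S) x ∂(γ : Measure S)) 0]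

/-- A single `g` forces finite entropy `r`; then every `g` gives `∫ g d(μ - γ) ≤ c - r`. The
nonnegativity clause rules out truncation by `ENNReal.ofReal`. -/
theorem relEntropy_add_gammaWeight_le {ν γ : ProbabilityMeasure S}
    (h : ∀ g ∈ Γ, 0 ≤ c - pairing g μ + ∫ x, g x ∂(γ : Measure S) ∧
      klDiv (γ : Measure S) (ν : Measure S) ≤
        ENNReal.ofReal (c - pairing g μ + ∫ x, g x ∂(γ : Measure S))) (hΓ : Γ.Nonempty) :
    relEntropy γ ν + gammaWeight Γ (μ - (γ : Measure S).toSignedMeasure) ≤ c := by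
  obtain ⟨g₀, hg₀⟩ := hΓ
  have htop : klDiv (γ : Measure S) (ν : Measure S) ≠ ⊤ :=
    ((h g₀ hg₀).2.trans_lt ENNReal.ofReal_lt_top).ne
  set r := (klDiv (γ : Measure S) (ν : Measure S)).toReal with hr
  have hrel : relEntropy γ ν = (r : EReal) := by
    rw [relEntropy, ← ENNReal.ofReal_toReal htop, EReal.coe_ennreal_ofReal,
      max_eq_left ENNReal.toReal_nonneg]
  have hW : gammaWeight Γ (μ - (γ : Measure S).toSignedMeasure) ≤ ((c - r : ℝ) : EReal) := by
    refine iSup₂_le fun g hg ↦ EReal.coe_le_coe_iff.2 ?_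
    have := ENNReal.toReal_le_of_le_ofReal (h g hg).1 (h g hg).2
    rw [pairing_sub_toSignedMeasure]
    linarith
  calc relEntropy γ ν + gammaWeight Γ (μ - (γ : Measure S).toSignedMeasure)
      ≤ (r : EReal) + ((c - r : ℝ) : EReal) := add_le_add hrel.le hW
    _ = c := by rw [← EReal.coe_add]; simp

end Duality

end GammaDivergence

/-! ### The variational formula -/

theorem mainTheorem1 {S : Type*} [TopologicalSpace S] [PolishSpace S]
    [MeasurableSpace S] [BorelSpace S]
    (Γ : Set (S →ᵇ ℝ)) (hΓ : GammaDivergence.IsAdmissible Γ)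
    (μ : SignedMeasure S) (ν : ProbabilityMeasure S) :
    GammaDivergence.gammaDiv Γ μ ν =
      ⨅ γ : ProbabilityMeasure S,
        (GammaDivergence.relEntropy γ ν +
          GammaDivergence.gammaWeight Γ (μ - (γ : Measure S).toSignedMeasure)) := by
  open GammaDivergence in
  have hne : Γ.Nonempty := ⟨_, hΓ.const_mem 0⟩
  have hle (g : S →ᵇ ℝ) (hg : g ∈ Γ) :
      ((dualObjective μ (ν : Measure S) g : ℝ) : EReal) ≤ gammaDiv Γ μ ν :=
    le_iSup₂ (f := fun (g : S →ᵇ ℝ) (_ : g ∈ Γ) ↦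
      ((dualObjective μ (ν : Measure S) g : ℝ) : EReal)) g hg
  refine le_antisymm
    (le_iInf fun γ ↦ iSup₂_le fun g hg ↦ dualObjective_le_relEntropy_add_gammaWeight hg γ) ?_
  by_cases htop : gammaDiv Γ μ ν = ⊤
  · exact htop ▸ le_top
  have hbot : gammaDiv Γ μ ν ≠ ⊥ := fun h ↦ by
    obtain ⟨g, hg⟩ := hne
    exact EReal.coe_ne_bot _ (le_bot_iff.1 (h ▸ hle g hg))
  have hc := EReal.coe_toReal htop hbot
  set c := (gammaDiv Γ μ ν).toReal
  have hlub : IsLUB (dualObjective μ (ν : Measure S) '' Γ) c := by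
    constructor
    · rintro _ ⟨g, hg, rfl⟩
      exact EReal.coe_le_coe_iff.1 (hc ▸ hle g hg)
    · intro b hb
      rw [← EReal.coe_le_coe_iff, hc]
      exact iSup₂_le fun g hg ↦ EReal.coe_le_coe_iff.2 (hb ⟨g, hg, rfl⟩)
  obtain ⟨γ, hγ, h⟩ := exists_klDiv_le hΓ.convex hlub
  exact (iInf_le _ (⟨γ, hγ⟩ : ProbabilityMeasure S)).trans
    ((relEntropy_add_gammaWeight_le h hne).trans hc.le)
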